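/- Let $n\in\mathbb N$, $s\in(0,1)$, let $\Omega\subset\mathbb R^n$ be a bounded open set with Lipschitz boundary (that is, near each point of $\partial\Omega$ and in suitable orthonormal coordinates, $\Omega$ is the strict subgraph of a Lipschitz function), and let $E\subset\mathbb R^n$ be a Lebesgue measurable set. For disjoint measurable sets $A,B\subset\mathbb R^n$ put $$\mathcal L_s(A,B):=\int_A\int_B\frac{1}{|x-y|^{n+s}}\,dx\,dy\in[0,\infty],$$ and for measurable $F\subset\mathbb R^n$, with $\mathcal C F:=\mathbb R^n\setminus F$, let $$P_s(F,\Omega):=\mathcal L_s(F\cap\Omega,\mathcal C F\cap\Omega)+\mathcal L_s(F\cap\Omega,\mathcal C F\setminus\Omega)+\mathcal L_s(F\setminus\Omega,\mathcal C F\cap\Omega)\in[0,\infty]$$ be the $s$-fractional perimeter of $F$ in $\Omega$. Then $$P_s(E,\Omega)=\inf\Big\{\liminf_{h\to\infty}P_s(E_h,\Omega)\ \Big|\ E_h\subset\mathbb R^n\text{ open with smooth boundary, such that }E_h\xrightarrow{loc}E\Big\}$$ (both sides finite or both equal to $+\infty$). Here $E_h\xrightarrow{loc}E$ means that $\chi_{E_h}\to\chi_E$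 in $L^1_{loc}(\mathbb R^n)$, i.e. $|(E_h\Delta E)\cap U|\to0$ for every bounded open set $U\subset\mathbb R^n$; and an open set has smooth boundary if near each of its boundary points it is of the form $\{\varphi<0\}$, where $\varphi$ is a $C^\infty$ function whose differential does not vanish at that point. -/

import Mathlib

open MeasureTheory Filter Topology
open scoped ENNReal ContDiff

noncomputable section

/-- The interaction `∫_A ∫_B |x - y|^{-(n + s)} dx dy ∈ [0, ∞]` of two (disjoint) sets. -/
def interaction {n : ℕ} (s : ℝ) (A B : Set (EuclideanSpace ℝ (Fin n))) : ℝ≥0∞ :=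
  ∫⁻ x in A, ∫⁻ y in B, 1 / ENNReal.ofReal (‖x - y‖ ^ ((n : ℝ) + s))

/-- The `s`-fractional perimeter `P_s(E, Ω) ∈ [0, ∞]` of `E` in `Ω`. -/
def fracPerimeter {n : ℕ} (s : ℝ) (E Ω : Set (EuclideanSpace ℝ (Fin n))) : ℝ≥0∞ :=
  interaction s (E ∩ Ω) (Eᶜ ∩ Ω) + interaction s (E ∩ Ω) (Eᶜ \ Ω)
    + interaction s (E \ Ω) (Eᶜ ∩ Ω)

/-- Local convergence of sets, i.e. convergence of the indicator functions in `L¹_loc(ℝⁿ)`: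
`|(F_h Δ E) ∩ U| → 0` for every bounded open set `U`. -/
def ConvergesLocally {n : ℕ} (F : ℕ → Set (EuclideanSpace ℝ (Fin n)))
    (E : Set (EuclideanSpace ℝ (Fin n))) : Prop :=
  ∀ U : Set (EuclideanSpace ℝ (Fin n)), IsOpen U → Bornology.IsBounded U →
    Tendsto (fun h => volume (symmDiff (F h) E ∩ U)) atTop (𝓝 0)

/-- Lipschitz boundary: near each boundary point, in suitable orthonormal coordinates whose last
axis is spanned by the unit vector `e`, the set is the strict subgraph of a Lipschitz function of
the remaining coordinates (here `y - ⟪e, y⟫ e` is the projection of `y` onto the hyperplane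
orthogonal to `e`). -/
def HasLipschitzBoundary {n : ℕ} (Ω : Set (EuclideanSpace ℝ (Fin n))) : Prop :=
  ∀ x ∈ frontier Ω, ∃ U : Set (EuclideanSpace ℝ (Fin n)), IsOpen U ∧ x ∈ U ∧
    ∃ e : EuclideanSpace ℝ (Fin n), ‖e‖ = 1 ∧
    ∃ (K : NNReal) (g : EuclideanSpace ℝ (Fin n) → ℝ), LipschitzWith K g ∧
      Ω ∩ U = {y ∈ U | inner ℝ e y < g (y - (inner ℝ e y : ℝ) • e)}

/-- Smooth (`C^∞`) boundary: near each boundary point the set is `{φ < 0}` for a smooth local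
defining function `φ` with nonvanishing differential at that point. -/
def HasSmoothBoundary {n : ℕ} (E : Set (EuclideanSpace ℝ (Fin n))) : Prop :=
  ∀ x ∈ frontier E, ∃ U : Set (EuclideanSpace ℝ (Fin n)), IsOpen U ∧ x ∈ U ∧
    ∃ φ : EuclideanSpace ℝ (Fin n) → ℝ, ContDiffOn ℝ ∞ φ U ∧ fderiv ℝ φ x ≠ 0 ∧
      E ∩ U = {y ∈ U | φ y < 0}

end

/-! The perimeter of `F` is the value at the indicator of `F` of the functional `J(u) = ∬ |x -
y|^{-(n+s)} (u x - u y)⁺`, taken over pairs that meet `Ω` (`fracPerimeter_eq_fracVariation`). Lower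
semicontinuity is Fatou's lemma along an a.e. convergent subsequence.

For the other inequality, with finite perimeter, smooth the indicator of `E` and pass to superlevel
sets. A mollification averages translates, so its `J` in `Ω` is bounded by the variation in a
neighbourhood of `Ω`, which `P_s(E, Ω)` does not control. The Lipschitz boundary repairs this: a
bi-Lipschitz map `Φ` close to the identity carries a neighbourhood of `Ω` into `Ω`
(`HasLipschitzBoundary.exists_mapsTo_thickening`), and composing with `Φ` multiplies `J` by a factor
close to 1 (`fracVariation_comp_le`).

Regular levels come from a small linear perturbation of the smooth function `v`: for suitable small
`ℓ`, the critical points of `v - ℓ` are isolated, so its critical values are countable. After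
truncation to `[0, 1]`, subtracting `ℓ` with `‖ℓ‖ ≤ ε` adds at most `min 1 (ε |x - y|)` to each
increment. Because `0 < s < 1` and `|Ω| < ∞`, this has small integral against the kernel.

By the coarea inequality, the mean over `t ∈ (0, 1)` of the perimeters of `{t < u}` is at most `J`
of the truncated `u`. Fatou's lemma in `t` then selects one level that serves the whole sequence of
approximations. -/

/-! ### The perimeter as a double integral -/

/-- Euclidean space of dimension `n`. -/
abbrev Euc (n : ℕ) : Type := EuclideanSpace ℝ (Fin n)

/-- The fractional kernel `|x - y|^{-(n + s)}`. -/
noncomputable def fracKernel {n : ℕ} (s : ℝ) (p : Euc n × Euc n) : ℝ≥0∞ :=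
  1 / ENNReal.ofReal (‖p.1 - p.2‖ ^ ((n : ℝ) + s))

/-- The pairs of points at least one of which lies in `Ω`. -/
def touching {n : ℕ} (Ω : Set (Euc n)) : Set (Euc n × Euc n) := {p | p.1 ∈ Ω ∨ p.2 ∈ Ω}

/-- The (one-sided) fractional total variation of a function in `Ω`. -/
noncomputable def fracVariation {n : ℕ} (s : ℝ) (u : Euc n → ℝ) (Ω : Set (Euc n)) : ℝ≥0∞ :=
  ∫⁻ p in touching Ω, fracKernel s p * ENNReal.ofReal (u p.1 - u p.2)

lemma measurable_fracKernel {n : ℕ} (s : ℝ) : Measurable (fracKernel (n := n) s) := by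
  unfold fracKernel
  fun_prop

lemma measurableSet_touching {n : ℕ} {Ω : Set (Euc n)} (hΩ : MeasurableSet Ω) :
    MeasurableSet (touching Ω) :=
  (measurable_fst hΩ).union (measurable_snd hΩ)

lemma interaction_eq_lintegral_prod {n : ℕ} (s : ℝ) (A B : Set (Euc n)) :
    interaction s A B = ∫⁻ p in A ×ˢ B, fracKernel s p := by
  rw [Measure.volume_eq_prod, ← Measure.prod_restrict,
    lintegral_prod _ (measurable_fracKernel s).aemeasurable]
  rfl

lemma fracPerimeter_eq_lintegral {n : ℕ} (s : ℝ) {F Ω : Set (Euc n)} (hF : MeasurableSet F)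
    (hΩ : MeasurableSet Ω) :
    fracPerimeter s F Ω = ∫⁻ p in touching Ω ∩ F ×ˢ Fᶜ, fracKernel s p := by
  unfold fracPerimeter
  rw [interaction_eq_lintegral_prod, interaction_eq_lintegral_prod, interaction_eq_lintegral_prod,
    ← lintegral_union, ← lintegral_union]
  · congr 2
    ext p
    simp only [touching, Set.mem_union, Set.mem_prod, Set.mem_inter_iff, Set.mem_compl_iff,
      Set.mem_sdiff, Set.mem_ofPred_eq]
    tauto
  · exact (hF.diff hΩ).prod (hF.compl.inter hΩ)
  · rw [Set.disjoint_left]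
    simp only [Set.mem_union, Set.mem_prod, Set.mem_inter_iff, Set.mem_compl_iff, Set.mem_sdiff]
    tauto
  · exact (hF.inter hΩ).prod (hF.compl.diff hΩ)
  · rw [Set.disjoint_left]
    simp only [Set.mem_prod, Set.mem_inter_iff, Set.mem_compl_iff, Set.mem_sdiff]
    tauto

lemma ofReal_indicator_sub_indicator {α : Type*} (F : Set α) (x y : α) :
    ENNReal.ofReal (F.indicator 1 x - F.indicator 1 y)
      = (F ×ˢ Fᶜ).indicator (1 : α × α → ℝ≥0∞) (x, y) := by
  by_cases hx : x ∈ F <;> by_cases hy : y ∈ F <;> simp [Set.indicator, hx, hy]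

lemma fracPerimeter_eq_fracVariation {n : ℕ} (s : ℝ) {F Ω : Set (Euc n)} (hF : MeasurableSet F)
    (hΩ : MeasurableSet Ω) :
    fracPerimeter s F Ω = fracVariation s (F.indicator 1) Ω := by
  rw [fracPerimeter_eq_lintegral s hF hΩ, fracVariation, Set.inter_comm,
    ← Measure.restrict_restrict (hF.prod hF.compl), ← lintegral_indicator (hF.prod hF.compl)]
  refine lintegral_congr fun p => ?_
  rw [ofReal_indicator_sub_indicator]
  by_cases hp : p ∈ F ×ˢ Fᶜ <;> simp [hp]

/-! ### Null modifications and lower semicontinuity -/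

lemma interaction_congr {n : ℕ} (s : ℝ) {A A' B B' : Set (Euc n)} (hA : A =ᵐ[volume] A')
    (hB : B =ᵐ[volume] B') : interaction s A B = interaction s A' B' := by
  unfold interaction
  rw [Measure.restrict_congr_set hA, Measure.restrict_congr_set hB]

lemma fracPerimeter_congr {n : ℕ} (s : ℝ) {E E' : Set (Euc n)} (h : E =ᵐ[volume] E')
    (Ω : Set (Euc n)) : fracPerimeter s E Ω = fracPerimeter s E' Ω := by
  have hc : (Eᶜ : Set (Euc n)) =ᵐ[volume] (E'ᶜ : Set (Euc n)) := h.compl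
  have r : Ω =ᵐ[volume] Ω := ae_eq_refl _
  unfold fracPerimeter
  rw [interaction_congr s (h.inter r) (hc.inter r), interaction_congr s (h.inter r) (hc.diff r),
    interaction_congr s (h.diff r) (hc.inter r)]

lemma ConvergesLocally.congr {n : ℕ} {F : ℕ → Set (Euc n)} {E E' : Set (Euc n)}
    (h : E =ᵐ[volume] E') (hF : ConvergesLocally F E) : ConvergesLocally F E' := by
  intro U hU hU'
  refine (hF U hU hU').congr fun k => measure_congr ?_
  have r : F k =ᵐ[volume] F k := ae_eq_refl _
  exact (((r.diff h).union (h.diff r))).inter (ae_eq_refl U)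

/-- Borel–Cantelli: the `m`-th index is chosen with error below `2⁻ᵐ` on the ball of radius `m`. The
predicate `p` lets the indices be restricted to sets whose perimeter lies below a level above the
liminf. -/
lemma ConvergesLocally.exists_subseq_ae {n : ℕ} {F : ℕ → Set (Euc n)} {E : Set (Euc n)}
    (hF : ConvergesLocally F E) {p : ℕ → Prop} (hp : ∃ᶠ k in atTop, p k) :
    ∃ φ : ℕ → ℕ, (∀ k, p (φ k)) ∧ ∀ᵐ x, ∀ᶠ k in atTop, (x ∈ F (φ k) ↔ x ∈ E) := by
  have key : ∀ m : ℕ, ∃ᶠ k in atTop,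
      p k ∧ volume (symmDiff (F k) E ∩ Metric.ball 0 m) < (2⁻¹ : ℝ≥0∞) ^ m := fun m =>
    hp.and_eventually ((hF _ Metric.isOpen_ball Metric.isBounded_ball).eventually_lt_const
      (ENNReal.pow_pos (by simp) m))
  obtain ⟨φ, -, h⟩ := extraction_forall_of_frequently key
  refine ⟨φ, fun k => (h k).1, ?_⟩
  have hsum : ∑' m, volume (symmDiff (F (φ m)) E ∩ Metric.ball 0 m) ≠ ⊤ := by
    refine ne_top_of_le_ne_top ?_ (ENNReal.tsum_le_tsum fun m => (h m).2.le)
    rw [ENNReal.tsum_geometric]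
    simp
  filter_upwards [ae_eventually_notMem hsum] with x hx
  obtain ⟨N, hN⟩ := exists_nat_gt ‖x‖
  filter_upwards [hx, eventually_ge_atTop N] with k hk hkN
  have hxk : x ∈ Metric.ball (0 : Euc n) k := by
    rw [mem_ball_zero_iff]
    exact hN.trans_le (by exact_mod_cast hkN)
  have : x ∉ symmDiff (F (φ k)) E := fun h' => hk ⟨h', hxk⟩
  rw [Set.mem_symmDiff] at this
  tauto

/-- Fatou's lemma for the fractional variation. -/
lemma fracVariation_le_liminf {n : ℕ} (s : ℝ) {u : ℕ → Euc n → ℝ} {v : Euc n → ℝ}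
    (Ω : Set (Euc n)) (hu : ∀ k, Measurable (u k))
    (h : ∀ᵐ x, Tendsto (fun k => u k x) atTop (𝓝 (v x))) :
    fracVariation s v Ω ≤ liminf (fun k => fracVariation s (u k) Ω) atTop := by
  have hmeas : ∀ k, Measurable fun p : Euc n × Euc n =>
      fracKernel s p * ENNReal.ofReal (u k p.1 - u k p.2) := fun k =>
    (measurable_fracKernel s).mul
      (((hu k).comp measurable_fst).sub ((hu k).comp measurable_snd)).ennreal_ofReal
  refine le_trans (lintegral_mono_ae ?_) (lintegral_liminf_le hmeas)
  refine ae_restrict_of_ae ?_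
  have h1 : ∀ᵐ p : Euc n × Euc n, Tendsto (fun k => u k p.1) atTop (𝓝 (v p.1)) :=
    Measure.quasiMeasurePreserving_fst.ae h
  have h2 : ∀ᵐ p : Euc n × Euc n, Tendsto (fun k => u k p.2) atTop (𝓝 (v p.2)) :=
    Measure.quasiMeasurePreserving_snd.ae h
  filter_upwards [h1, h2] with p hp1 hp2
  have ht := ENNReal.tendsto_ofReal (hp1.sub hp2)
  -- The kernel is infinite on the diagonal, and multiplication by `⊤` is continuous only away from
  -- `0`; where the limit vanishes the inequality is trivial.
  rcases eq_or_ne (ENNReal.ofReal (v p.1 - v p.2)) 0 with h0 | h0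
  · simp [h0]
  · exact (ENNReal.Tendsto.const_mul ht (Or.inl h0)).liminf_eq.ge

/-- Lower semicontinuity of the fractional perimeter. -/
lemma fracPerimeter_le_liminf {n : ℕ} (s : ℝ) {F : ℕ → Set (Euc n)} {E Ω : Set (Euc n)}
    (hΩ : MeasurableSet Ω) (hF : ∀ k, MeasurableSet (F k)) (hE : MeasurableSet E)
    (h : ConvergesLocally F E) :
    fracPerimeter s E Ω ≤ liminf (fun k => fracPerimeter s (F k) Ω) atTop := by
  refine le_of_forall_gt_imp_ge_of_dense fun c hc => ?_
  obtain ⟨φ, hlt, hae⟩ := h.exists_subseq_ae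
    (frequently_lt_of_liminf_lt (by isBoundedDefault) hc)
  rw [fracPerimeter_eq_fracVariation s hE hΩ]
  refine (fracVariation_le_liminf s (u := fun k => (F (φ k)).indicator 1) Ω
    (fun k => measurable_one.indicator (hF _)) ?_).trans ?_
  · filter_upwards [hae] with x hx
    refine tendsto_const_nhds.congr' ?_
    filter_upwards [hx] with k hk
    by_cases hxE : x ∈ E <;> simp [Set.indicator, hk, hxE]
  · refine liminf_le_of_le (by isBoundedDefault) fun b hb => ?_
    obtain ⟨k, hk⟩ := hb.exists
    rw [← fracPerimeter_eq_fracVariation s (hF _) hΩ] at hk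
    exact hk.trans (hlt k).le

/-! ### Pushing a Lipschitz domain into itself -/

/-- `Φ` is a bi-Lipschitz map, `ε`-close to the identity, that keeps `Ω` and pushes the boundary
points of `Ω` in `S` into `Ω`. -/
structure PushesInward {n : ℕ} (Ω S : Set (Euc n)) (ε : NNReal) (Φ : Euc n → Euc n) : Prop where
  lipschitz : LipschitzWith (1 + ε) Φ
  antilipschitz : AntilipschitzWith (1 + ε) Φ
  dist_le : ∀ x, dist (Φ x) x ≤ ε
  mapsTo : Set.MapsTo Φ Ω Ω
  eq_or_mem : ∀ x ∈ closure Ω, Φ x = x ∨ Φ x ∈ Ω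
  mem : ∀ x ∈ S ∩ frontier Ω, Φ x ∈ Ω

lemma PushesInward.mono {n : ℕ} {Ω S S' : Set (Euc n)} {ε : NNReal} {Φ : Euc n → Euc n}
    (h : PushesInward Ω S' ε Φ) (hS : S ⊆ S') : PushesInward Ω S ε Φ :=
  { h with mem := fun x hx => h.mem x ⟨hS hx.1, hx.2⟩ }

/-- The field `eq_or_mem` makes local pushes compose: a point of `T` is either fixed by `Φ` and then
pushed by `Ψ`, or already in `Ω`, which `Ψ` preserves. The hypothesis on `δ` also gives `2δ ≤ ε`,
which bounds the total displacement. -/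
lemma PushesInward.comp {n : ℕ} {Ω S T : Set (Euc n)} {ε δ : NNReal} {Φ Ψ : Euc n → Euc n}
    (hε : (1 + δ) * (1 + δ) ≤ 1 + ε)
    (hΦ : PushesInward Ω S δ Φ) (hΨ : PushesInward Ω T δ Ψ) :
    PushesInward Ω (S ∪ T) ε (Ψ ∘ Φ) where
  lipschitz := (hΨ.lipschitz.comp hΦ.lipschitz).weaken hε
  antilipschitz := fun x y =>
    (hΨ.antilipschitz.comp hΦ.antilipschitz x y).trans (by gcongr)
  dist_le x := by
    have h1 := hΨ.dist_le (Φ x)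
    have h2 := hΦ.dist_le x
    have h3 := dist_triangle (Ψ (Φ x)) (Φ x) x
    have h4 : ((1 : ℝ) + δ) * (1 + δ) ≤ 1 + ε := by exact_mod_cast hε
    have h5 : (0 : ℝ) ≤ δ := δ.2
    simp only [Function.comp]
    nlinarith
  mapsTo := hΨ.mapsTo.comp hΦ.mapsTo
  eq_or_mem x hx := by
    simp only [Function.comp]
    rcases hΦ.eq_or_mem x hx with h | h
    · rw [h]
      exact hΨ.eq_or_mem x hx
    · exact Or.inr (hΨ.mapsTo h)
  mem x hx := by
    simp only [Function.comp]
    rcases hΦ.eq_or_mem x (frontier_subset_closure hx.2) with h | h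
    · rcases hx.1 with hS | hT
      · exact hΨ.mapsTo (hΦ.mem x ⟨hS, hx.2⟩)
      · rw [h]
        exact hΨ.mem x ⟨hT, hx.2⟩
    · exact hΨ.mapsTo h

lemma pushesInward_id {n : ℕ} (Ω : Set (Euc n)) (ε : NNReal) : PushesInward Ω ∅ ε id where
  lipschitz := LipschitzWith.id.weaken (by simp)
  antilipschitz := fun x y =>
    (AntilipschitzWith.id x y).trans (by gcongr; simp)
  dist_le x := by simp
  mapsTo := Set.mapsTo_id _
  eq_or_mem x _ := Or.inl rfl
  mem x hx := hx.1.elim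

/-- By the triangle inequality distances change by factors between `1 - τ` and `1 + τ`; `hτ` says `1
/ (1 - τ) ≤ 1 + ε`. -/
lemma lipschitz_antilipschitz_of_dist_sub_le {V : Type*} [NormedAddCommGroup V] {Φ : V → V}
    {τ ε : NNReal} (hτ : 1 ≤ (1 + ε) * (1 - τ : ℝ)) (hτε : τ ≤ ε)
    (h : ∀ x y, ‖(Φ x - Φ y) - (x - y)‖ ≤ τ * ‖x - y‖) :
    LipschitzWith (1 + ε) Φ ∧ AntilipschitzWith (1 + ε) Φ := by
  have hτε' : (τ : ℝ) ≤ ε := by exact_mod_cast hτε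
  constructor
  · refine LipschitzWith.of_dist_le_mul fun x y => ?_
    rw [dist_eq_norm, dist_eq_norm]
    have h1 := norm_add_le ((Φ x - Φ y) - (x - y)) (x - y)
    rw [sub_add_cancel] at h1
    push_cast
    nlinarith [h x y, norm_nonneg (x - y)]
  · refine AntilipschitzWith.of_le_mul_dist fun x y => ?_
    rw [dist_eq_norm, dist_eq_norm]
    have h1 := norm_sub_le (Φ x - Φ y) ((Φ x - Φ y) - (x - y))
    rw [sub_sub_cancel] at h1
    push_cast
    have h2 : (1 - τ) * ‖x - y‖ ≤ ‖Φ x - Φ y‖ := by nlinarith [h x y]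
    have h3 : (0 : ℝ) ≤ 1 + ε := by positivity
    have h4 := mul_le_mul_of_nonneg_left h2 h3
    have h5 := mul_le_mul_of_nonneg_right hτ (norm_nonneg (x - y))
    nlinarith

/-- In the chart, slide points along `-e` by a small multiple of a tent function. The projection
orthogonal to `e` is unchanged, so points on or below the graph land strictly below it. The radius
is fixed before `ε`, as the compactness argument requires. -/
lemma HasLipschitzBoundary.exists_pushesInward_ball {n : ℕ} {Ω : Set (Euc n)}
    (hΩ : HasLipschitzBoundary Ω) {x : Euc n} (hx : x ∈ frontier Ω) :
    ∃ r > 0, ∀ ε : NNReal, 0 < ε → ∃ Φ, PushesInward Ω (Metric.ball x r) ε Φ := by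
  obtain ⟨U, hU, hxU, e, he, K, g, hg, hΩU⟩ := hΩ x hx
  obtain ⟨R, hR, hRU⟩ := Metric.isOpen_iff.1 hU x hxU
  have hr : 0 < R / 2 := by positivity
  refine ⟨R / 2, hr, fun ε hε => ?_⟩
  set r := R / 2 with hrdef
  have hε' : (0 : ℝ) < ε := hε
  -- Take `τ = min (ε / (1 + ε)) (ε / r)`: the first term controls the Lipschitz constants, the
  -- second the displacement.
  obtain ⟨τ, hτ0, hτ1, hτε, hτr, hτ⟩ : ∃ τ : NNReal, 0 < τ ∧ τ ≤ 1 ∧ τ ≤ ε ∧ (τ * r : ℝ) ≤ ε ∧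
      1 ≤ (1 + ε) * (1 - τ : ℝ) := by
    have hpos : (0 : ℝ) < min ((ε : ℝ) / (1 + ε)) ((ε : ℝ) / r) := by positivity
    have a1 : min ((ε : ℝ) / (1 + ε)) ((ε : ℝ) / r) ≤ ε / (1 + ε) := min_le_left _ _
    have a2 : min ((ε : ℝ) / (1 + ε)) ((ε : ℝ) / r) ≤ ε / r := min_le_right _ _
    rw [le_div_iff₀ (by positivity)] at a1 a2
    generalize min ((ε : ℝ) / (1 + ε)) ((ε : ℝ) / r) = τ at *
    lift τ to NNReal using hpos.le
    refine ⟨τ, by exact_mod_cast hpos, ?_, ?_, a2, ?_⟩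
    · rw [← NNReal.coe_le_coe, NNReal.coe_one]
      nlinarith
    · rw [← NNReal.coe_le_coe]
      nlinarith
    · nlinarith
  have hτ0' : (0 : ℝ) < τ := hτ0
  have hτ1' : (τ : ℝ) ≤ 1 := by exact_mod_cast hτ1
  set η : Euc n → ℝ := fun y => max 0 (r - ‖y - x‖) with hη
  have hη0 : ∀ y, 0 ≤ η y := fun y => le_max_left _ _
  have hηr : ∀ y, η y ≤ r := fun y => max_le hr.le (by linarith [norm_nonneg (y - x)])
  have hηpos : ∀ y, 0 < η y ↔ y ∈ Metric.ball x r := fun y => by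
    rw [mem_ball_iff_norm, hη]
    simp
  have hηlip : ∀ y z, |η y - η z| ≤ ‖y - z‖ := fun y z => by
    refine (abs_max_sub_max_le_max _ _ _ _).trans (max_le (by simp) ?_)
    have := abs_norm_sub_norm_le (z - x) (y - x)
    rw [sub_sub_sub_cancel_right, norm_sub_rev z y] at this
    rwa [sub_sub_sub_cancel_left]
  set Φ : Euc n → Euc n := fun y => y - (τ * η y) • e with hΦ
  have hτη : ∀ y, 0 ≤ τ * η y := fun y => mul_nonneg hτ0'.le (hη0 y)
  have hdist : ∀ y, dist (Φ y) y = τ * η y := fun y => by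
    rw [dist_eq_norm, hΦ]
    simp only [sub_sub_cancel_left, norm_neg, norm_smul, he, mul_one, Real.norm_eq_abs,
      abs_of_nonneg (hτη y)]
  have hfix : ∀ y, y ∉ Metric.ball x r → Φ y = y := fun y hy => by
    have : η y = 0 := le_antisymm (not_lt.1 fun h => hy ((hηpos y).1 h)) (hη0 y)
    simp [hΦ, this]
  -- The displacement is at most `r = R / 2`, so the image stays in the ball of radius `R`, where
  -- the graph description is valid.
  have hstay : ∀ y ∈ Metric.ball x r, Φ y ∈ U := fun y hy => hRU <| by
    have h1 := dist_triangle (Φ y) y x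
    have h2 : τ * η y ≤ r := (mul_le_of_le_one_left (hη0 y) hτ1').trans (hηr y)
    rw [hdist] at h1
    rw [Metric.mem_ball] at hy ⊢
    linarith
  have hsub : Metric.ball x r ⊆ U := (Metric.ball_subset_ball (by linarith)).trans hRU
  have hinner : ∀ y, inner ℝ e (Φ y) = inner ℝ e y - τ * η y := fun y => by
    simp [hΦ, inner_sub_right, inner_smul_right, he]
  have hproj : ∀ y, Φ y - (inner ℝ e (Φ y) : ℝ) • e = y - (inner ℝ e y : ℝ) • e := fun y => by
    rw [hinner, sub_smul]
    simp only [hΦ]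
    abel
  have hmem : ∀ y ∈ U, (y ∈ Ω ↔ inner ℝ e y < g (y - (inner ℝ e y : ℝ) • e)) := fun y hy => by
    have := Set.ext_iff.1 hΩU y
    simpa [hy] using this
  have hclosure : ∀ y ∈ closure Ω, y ∈ Metric.ball x r → Φ y ∈ Ω := by
    intro y hy hyr
    have hyU := hsub hyr
    have hle : inner ℝ e y ≤ g (y - (inner ℝ e y : ℝ) • e) := by
      have hcl : y ∈ closure (Ω ∩ U) := by
        rw [Set.inter_comm]
        exact hU.inter_closure ⟨hyU, hy⟩
      have hclosed : IsClosed {z : Euc n | inner ℝ e z ≤ g (z - (inner ℝ e z : ℝ) • e)} :=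
        isClosed_le (by fun_prop) (hg.continuous.comp (by fun_prop))
      refine closure_minimal ?_ hclosed hcl
      rintro z ⟨hz, hzU⟩
      exact ((hmem z hzU).1 hz).le
    rw [hmem _ (hstay y hyr), hproj, hinner]
    have := mul_pos hτ0' ((hηpos y).2 hyr)
    linarith
  obtain ⟨hL, hA⟩ := lipschitz_antilipschitz_of_dist_sub_le (Φ := Φ) hτ hτε fun y z => by
    have : Φ y - Φ z - (y - z) = -((τ * (η y - η z)) • e) := by
      simp only [hΦ, mul_sub, sub_smul]
      abel
    rw [this, norm_neg, norm_smul, he, mul_one, Real.norm_eq_abs, abs_mul, NNReal.abs_eq]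
    gcongr
    exact hηlip y z
  refine ⟨Φ, hL, hA, fun y => ?_, fun y hy => ?_, fun y hy => ?_, fun y hy => ?_⟩
  · rw [hdist]
    exact (mul_le_mul_of_nonneg_left (hηr y) hτ0'.le).trans hτr
  · by_cases hyr : y ∈ Metric.ball x r
    · exact hclosure y (subset_closure hy) hyr
    · rwa [hfix y hyr]
  · by_cases hyr : y ∈ Metric.ball x r
    · exact Or.inr (hclosure y hy hyr)
    · exact Or.inl (hfix y hyr)
  · exact hclosure y (frontier_subset_closure hy.2) hy.1

/-- A bounded open set with Lipschitz boundary can be pushed into itself, together with a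
neighbourhood of its closure, by bi-Lipschitz maps arbitrarily close to the identity. -/
lemma HasLipschitzBoundary.exists_mapsTo_thickening {n : ℕ} {Ω : Set (Euc n)}
    (hΩ : HasLipschitzBoundary Ω) (hopen : IsOpen Ω) (hb : Bornology.IsBounded Ω) {ε : NNReal}
    (hε : 0 < ε) :
    ∃ Φ : Euc n → Euc n, LipschitzWith (1 + ε) Φ ∧ AntilipschitzWith (1 + ε) Φ ∧
      (∀ x, dist (Φ x) x ≤ ε) ∧ ∃ δ > 0, Set.MapsTo Φ (Metric.thickening δ Ω) Ω := by
  have hcl : IsCompact (closure Ω) := hb.isCompact_closure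
  have hfr : IsCompact (frontier Ω) :=
    hcl.of_isClosed_subset isClosed_frontier frontier_subset_closure
  -- The induction predicate quantifies over every `ε`, so that the union step may ask for a smaller
  -- `δ` on both pieces.
  have key : ∀ ε : NNReal, 0 < ε → ∃ Φ, PushesInward Ω (frontier Ω) ε Φ := by
    refine hfr.induction_on (p := fun S => ∀ ε : NNReal, 0 < ε → ∃ Φ, PushesInward Ω S ε Φ)
      (fun ε _ => ⟨_, pushesInward_id Ω ε⟩)
      (fun S T hST hT ε hε => (hT ε hε).imp fun Φ h => h.mono hST) ?_ ?_
    · intro S T hS hT ε hε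
      obtain ⟨δ, hδ, hδε⟩ : ∃ δ : NNReal, 0 < δ ∧ (1 + δ) * (1 + δ) ≤ 1 + ε := by
        -- For `δ ≤ 1`, `(1 + δ)² ≤ 1 + 3δ`.
        refine ⟨min 1 (ε / 3), by positivity, ?_⟩
        have h1 : min 1 (ε / 3) ≤ 1 := min_le_left _ _
        have h2 : min 1 (ε / 3) ≤ ε / 3 := min_le_right _ _
        generalize min 1 (ε / 3) = δ at *
        rw [← NNReal.coe_le_coe] at *
        push_cast at *
        nlinarith [δ.2]
      obtain ⟨Φ, hΦ⟩ := hS δ hδ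
      obtain ⟨Ψ, hΨ⟩ := hT δ hδ
      exact ⟨_, PushesInward.comp hδε hΦ hΨ⟩
    · intro x hx
      obtain ⟨r, hr, h⟩ := hΩ.exists_pushesInward_ball hx
      exact ⟨_, mem_nhdsWithin_of_mem_nhds (Metric.ball_mem_nhds x hr), h⟩
  obtain ⟨Φ, hΦ⟩ := key ε hε
  refine ⟨Φ, hΦ.lipschitz, hΦ.antilipschitz, hΦ.dist_le, ?_⟩
  -- The compact closure of `Ω` lies in the open set `Φ⁻¹(Ω)`, hence so does a thickening of it.
  obtain ⟨δ, hδ, h⟩ := hcl.exists_thickening_subset_open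
    (hopen.preimage hΦ.lipschitz.continuous) (fun x hx => by
      rw [closure_eq_self_union_frontier] at hx
      rcases hx with hx | hx
      · exact hΦ.mapsTo hx
      · exact hΦ.mem x ⟨hx, hx⟩)
  exact ⟨δ, hδ, fun x hx => h (Metric.thickening_subset_of_subset δ subset_closure hx)⟩

/-! ### Composition with bi-Lipschitz maps -/

/-- Volume is a multiple of the `n`-dimensional Hausdorff measure, for which the bound is immediate;
no Jacobian is involved. -/
lemma AntilipschitzWith.volume_preimage_le {n : ℕ} {K : NNReal} {Φ : Euc n → Euc n}
    (hΦ : AntilipschitzWith K Φ) (S : Set (Euc n)) :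
    volume (Φ ⁻¹' S) ≤ (K : ℝ≥0∞) ^ n * volume S := by
  have hv : (volume : Measure (Euc n)) = _ :=
    Measure.isAddLeftInvariant_eq_smul volume (Measure.hausdorffMeasure (n : ℝ))
  rw [hv, Measure.smul_apply, Measure.smul_apply, ENNReal.smul_def, ENNReal.smul_def, smul_eq_mul,
    smul_eq_mul, mul_left_comm]
  gcongr
  have := hΦ.hausdorffMeasure_preimage_le (Nat.cast_nonneg n) S
  rwa [ENNReal.rpow_natCast] at this

lemma AntilipschitzWith.map_volume_le {n : ℕ} {K : NNReal} {Φ : Euc n → Euc n}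
    (hΦ : AntilipschitzWith K Φ) (hm : Measurable Φ) :
    (volume : Measure (Euc n)).map Φ ≤ (K : ℝ≥0∞) ^ n • volume := by
  refine Measure.le_iff.2 fun S hS => ?_
  rw [Measure.map_apply hm hS]
  exact hΦ.volume_preimage_le S

lemma AntilipschitzWith.lintegral_comp_le {n : ℕ} {K : NNReal} {Φ : Euc n → Euc n}
    (hΦ : AntilipschitzWith K Φ) (hm : Measurable Φ) {f : Euc n → ℝ≥0∞} (hf : Measurable f) :
    ∫⁻ x, f (Φ x) ≤ (K : ℝ≥0∞) ^ n * ∫⁻ x, f x := by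
  rw [← lintegral_map hf hm, ← smul_eq_mul, ← lintegral_smul_measure]
  exact lintegral_mono' (hΦ.map_volume_le hm) le_rfl

lemma AntilipschitzWith.setLIntegral_prodMap_le {n : ℕ} {K : NNReal} {Φ : Euc n → Euc n}
    (hΦ : AntilipschitzWith K Φ) (hm : Measurable Φ) {G : Euc n × Euc n → ℝ≥0∞}
    (hG : Measurable G) {T : Set (Euc n × Euc n)} (hT : MeasurableSet T) :
    ∫⁻ p in Prod.map Φ Φ ⁻¹' T, G (Prod.map Φ Φ p)
      ≤ (K : ℝ≥0∞) ^ n * (K : ℝ≥0∞) ^ n * ∫⁻ p in T, G p := by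
  have hle : (volume : Measure (Euc n × Euc n)).map (Prod.map Φ Φ)
      ≤ ((K : ℝ≥0∞) ^ n * (K : ℝ≥0∞) ^ n) • volume := by
    rw [Measure.volume_eq_prod, ← Measure.map_prod_map _ _ hm hm]
    refine (Measure.prod_mono (hΦ.map_volume_le hm) (hΦ.map_volume_le hm)).trans ?_
    rw [Measure.prod_smul_left, Measure.prod_smul_right, smul_smul]
  rw [← setLIntegral_map hT hG (hm.prodMap hm), ← smul_eq_mul, ← lintegral_smul_measure,
    ← Measure.restrict_smul]
  exact lintegral_mono' (Measure.restrict_mono' (ae_of_all _ fun _ h => h) hle) le_rfl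

lemma LipschitzWith.fracKernel_le {n : ℕ} {s : ℝ} (hs : 0 ≤ s) {K : NNReal} (hK : 0 < K)
    {Φ : Euc n → Euc n} (hΦ : LipschitzWith K Φ) (p : Euc n × Euc n) :
    fracKernel s p ≤ ENNReal.ofReal (K ^ ((n : ℝ) + s)) * fracKernel s (Prod.map Φ Φ p) := by
  have ha : 0 ≤ (n : ℝ) + s := by positivity
  have h1 : ENNReal.ofReal (‖Φ p.1 - Φ p.2‖ ^ ((n : ℝ) + s))
      ≤ ENNReal.ofReal (K ^ ((n : ℝ) + s)) * ENNReal.ofReal (‖p.1 - p.2‖ ^ ((n : ℝ) + s)) := by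
    rw [← ENNReal.ofReal_mul (by positivity), ← Real.mul_rpow (by positivity) (by positivity)]
    gcongr
    have := hΦ.dist_le_mul p.1 p.2
    rwa [dist_eq_norm, dist_eq_norm] at this
  have hC0 : ENNReal.ofReal (K ^ ((n : ℝ) + s)) ≠ 0 := by
    rw [Ne, ENNReal.ofReal_eq_zero, not_le]
    positivity
  have h2 := mul_le_mul_right (ENNReal.inv_le_inv.2 h1) (ENNReal.ofReal (K ^ ((n : ℝ) + s)))
  rw [ENNReal.mul_inv (Or.inl hC0) (Or.inl ENNReal.ofReal_ne_top), ← mul_assoc,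
    ENNReal.mul_inv_cancel hC0 ENNReal.ofReal_ne_top, one_mul] at h2
  simpa [fracKernel, one_div] using h2

/-- The Lipschitz bound compares the kernels, the antilipschitz bound pays for the change of
variables, and `hmaps` sends pairs touching `Ω'` to pairs touching `Ω`. It serves both the inward
push and, with `K = 1`, translations. -/
lemma fracVariation_comp_le {n : ℕ} {s : ℝ} (hs : 0 ≤ s) {K : NNReal} (hK : 0 < K)
    {Φ : Euc n → Euc n} (hL : LipschitzWith K Φ) (hA : AntilipschitzWith K Φ)
    {Ω Ω' : Set (Euc n)} (hΩ : MeasurableSet Ω) (hmaps : Set.MapsTo Φ Ω' Ω) {u : Euc n → ℝ}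
    (hu : Measurable u) :
    fracVariation s (u ∘ Φ) Ω' ≤ ENNReal.ofReal (K ^ ((n : ℝ) + s)) *
      ((K : ℝ≥0∞) ^ n * (K : ℝ≥0∞) ^ n) * fracVariation s u Ω := by
  have hm : Measurable Φ := hL.continuous.measurable
  have hG : Measurable fun p : Euc n × Euc n =>
      fracKernel s p * ENNReal.ofReal (u p.1 - u p.2) :=
    (measurable_fracKernel s).mul
      ((hu.comp measurable_fst).sub (hu.comp measurable_snd)).ennreal_ofReal
  calc fracVariation s (u ∘ Φ) Ω'
      ≤ ∫⁻ p in Prod.map Φ Φ ⁻¹' touching Ω,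
          fracKernel s p * ENNReal.ofReal (u (Φ p.1) - u (Φ p.2)) :=
        lintegral_mono_set fun p hp => hp.imp (fun h => hmaps h) (fun h => hmaps h)
    _ ≤ ∫⁻ p in Prod.map Φ Φ ⁻¹' touching Ω, ENNReal.ofReal (K ^ ((n : ℝ) + s)) *
          (fracKernel s (Prod.map Φ Φ p) * ENNReal.ofReal (u (Φ p.1) - u (Φ p.2))) := by
        refine lintegral_mono fun p => ?_
        rw [← mul_assoc]
        exact mul_le_mul_left (hL.fracKernel_le hs hK p) _
    _ = ENNReal.ofReal (K ^ ((n : ℝ) + s)) * ∫⁻ p in Prod.map Φ Φ ⁻¹' touching Ω,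
          (fracKernel s (Prod.map Φ Φ p) * ENNReal.ofReal (u (Φ p.1) - u (Φ p.2))) :=
        lintegral_const_mul' _ _ ENNReal.ofReal_ne_top
    _ ≤ _ := by
        rw [mul_assoc]
        exact mul_le_mul_right
          (hA.setLIntegral_prodMap_le hm hG (measurableSet_touching hΩ)) _

/-- Composition with bi-Lipschitz maps close to the identity is `L¹_loc`-close to the identity. -/
lemma exists_lintegral_comp_sub_le {n : ℕ} {f : Euc n → ℝ} (hf : Measurable f)
    (hfi : LocallyIntegrable f) (R : ℝ) (K : NNReal) {η : ℝ≥0∞} (hη : η ≠ 0) :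
    ∃ ε > 0, ∀ Φ : Euc n → Euc n, Continuous Φ → AntilipschitzWith K Φ →
      (∀ x, dist (Φ x) x ≤ ε) → ∫⁻ x in Metric.ball 0 R, ‖f (Φ x) - f x‖ₑ ≤ η := by
  -- Displacements will be at most 1, so only the values of `f` on this larger ball matter, and the
  -- cut-off function is integrable.
  set B : Set (Euc n) := Metric.ball 0 (R + 1)
  set f₁ : Euc n → ℝ := B.indicator f
  have hf₁ : Measurable f₁ := hf.indicator measurableSet_ball
  have hf₁i : Integrable f₁ := by
    rw [integrable_indicator_iff measurableSet_ball]
    exact (hfi.integrableOn_isCompact (isCompact_closedBall 0 (R + 1))).mono_set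
      Metric.ball_subset_closedBall
  -- The error of the approximation of `f₁` by `g` is paid once directly and once after composition
  -- with `Φ`, at the price `K ^ n`.
  set C : ℝ≥0∞ := (K : ℝ≥0∞) ^ n + 1
  have hCtop : C ≠ ⊤ := by simp [C]
  have hC0 : C ≠ 0 := by simp [C]
  obtain ⟨g, hgc, hfg, hg, -⟩ := hf₁i.exists_hasCompactSupport_lintegral_sub_le
    (ε := η / 2 / C) (by simp [hη, ENNReal.div_eq_zero_iff, hCtop])
  obtain ⟨θ, hθ, hθη⟩ := ENNReal.exists_nnreal_pos_mul_lt
    (measure_ball_lt_top (μ := volume) (x := (0 : Euc n)) (r := R)).ne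
    (b := η / 2) (by simp [hη, ENNReal.div_eq_zero_iff])
  obtain ⟨ε, hε, hgε⟩ := Metric.uniformContinuous_iff.1 
    (hgc.uniformContinuous_of_continuous hg) θ hθ
  refine ⟨min 1 (ε / 2), by positivity, fun Φ hΦc hΦ hdist => ?_⟩
  have hfgm : Measurable fun x => ‖f₁ x - g x‖ₑ := (hf₁.sub hg.measurable).enorm
  have hpt : ∀ x ∈ Metric.ball (0 : Euc n) R,
      ‖f (Φ x) - f x‖ₑ ≤ (‖f₁ (Φ x) - g (Φ x)‖ₑ + ‖f₁ x - g x‖ₑ) + θ := by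
    intro x hx
    have h1 : dist (Φ x) x ≤ 1 := (hdist x).trans (min_le_left _ _)
    have h2 : dist (Φ x) x < ε := ((hdist x).trans (min_le_right _ _)).trans_lt (by linarith)
    have hxB : x ∈ B := Metric.ball_subset_ball (by linarith) hx
    have hΦB : Φ x ∈ B := by
      rw [Metric.mem_ball] at hx ⊢
      linarith [dist_triangle (Φ x) x 0]
    have e1 : f x = f₁ x := (Set.indicator_of_mem hxB f).symm
    have e2 : f (Φ x) = f₁ (Φ x) := (Set.indicator_of_mem hΦB f).symm
    have h3 : ‖g (Φ x) - g x‖ₑ ≤ θ := by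
      have := (hgε h2).le
      rw [dist_eq_norm] at this
      rw [enorm_le_coe, ← NNReal.coe_le_coe]
      exact this
    have e3 : f (Φ x) - f x = (f₁ (Φ x) - g (Φ x)) - (f₁ x - g x) + (g (Φ x) - g x) := by
      rw [e1, e2]
      ring
    rw [e3]
    exact (enorm_add_le _ _).trans (add_le_add enorm_sub_le h3)
  calc ∫⁻ x in Metric.ball 0 R, ‖f (Φ x) - f x‖ₑ
      ≤ ∫⁻ x in Metric.ball (0 : Euc n) R,
          ((‖f₁ (Φ x) - g (Φ x)‖ₑ + ‖f₁ x - g x‖ₑ) + θ) :=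
        setLIntegral_mono' measurableSet_ball hpt
    _ = (∫⁻ x in Metric.ball (0 : Euc n) R, ‖f₁ (Φ x) - g (Φ x)‖ₑ)
          + (∫⁻ x in Metric.ball (0 : Euc n) R, ‖f₁ x - g x‖ₑ)
          + θ * volume (Metric.ball (0 : Euc n) R) := by
        rw [lintegral_add_right _ measurable_const, lintegral_add_right _ hfgm,
          setLIntegral_const]
    _ ≤ (∫⁻ x, ‖f₁ (Φ x) - g (Φ x)‖ₑ) + (∫⁻ x, ‖f₁ x - g x‖ₑ) + η / 2 := by
        exact add_le_add (add_le_add (setLIntegral_le_lintegral _ _)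
          (setLIntegral_le_lintegral _ _)) hθη.le
    _ ≤ (K : ℝ≥0∞) ^ n * (η / 2 / C) + η / 2 / C + η / 2 := by
        gcongr
        exact (hΦ.lintegral_comp_le hΦc.measurable hfgm).trans (by gcongr)
    _ = C * (η / 2 / C) + η / 2 := by
        simp only [C]
        ring
    _ = η := by
        rw [ENNReal.mul_div_cancel hC0 hCtop, ENNReal.add_halves]

/-! ### Mollification -/

/-- The mollification of `w` by a normalised bump function. -/
noncomputable def mollify {n : ℕ} (φ : ContDiffBump (0 : Euc n)) (w : Euc n → ℝ) : Euc n → ℝ :=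
  convolution (φ.normed volume) w (ContinuousLinearMap.lsmul ℝ ℝ) volume

lemma mollify_apply {n : ℕ} (φ : ContDiffBump (0 : Euc n)) (w : Euc n → ℝ) (x : Euc n) :
    mollify φ w x = ∫ z, φ.normed volume z * w (x - z) := rfl

lemma contDiff_mollify {n : ℕ} (φ : ContDiffBump (0 : Euc n)) {w : Euc n → ℝ}
    (hw : LocallyIntegrable w) : ContDiff ℝ ∞ (mollify φ w) :=
  φ.hasCompactSupport_normed.contDiff_convolution_left _ φ.contDiff_normed hw

lemma integrable_normed_mul {n : ℕ} (φ : ContDiffBump (0 : Euc n)) {w : Euc n → ℝ}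
    (hw : Measurable w) (hw1 : ∀ x, |w x| ≤ 1) (x : Euc n) :
    Integrable fun z => φ.normed volume z * w (x - z) :=
  φ.integrable_normed.mul_bdd (c := 1)
    (hw.comp (measurable_const.sub measurable_id)).aestronglyMeasurable (ae_of_all _ fun _ => hw1 _)

lemma lintegral_ofReal_normed {n : ℕ} (φ : ContDiffBump (0 : Euc n)) :
    ∫⁻ z, ENNReal.ofReal (φ.normed volume z) = 1 := by
  rw [← ofReal_integral_eq_lintegral_ofReal φ.integrable_normed
    (ae_of_all _ fun z => φ.nonneg_normed z), φ.integral_normed, ENNReal.ofReal_one]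

lemma lintegral_ofReal_normed_mul_le {n : ℕ} {φ : ContDiffBump (0 : Euc n)} {f : Euc n → ℝ≥0∞}
    {c : ℝ≥0∞} (h : ∀ z, ‖z‖ < φ.rOut → f z ≤ c) :
    ∫⁻ z, ENNReal.ofReal (φ.normed volume z) * f z ≤ c := by
  calc ∫⁻ z, ENNReal.ofReal (φ.normed volume z) * f z
      ≤ ∫⁻ z, ENNReal.ofReal (φ.normed volume z) * c := by
        refine lintegral_mono fun z => ?_
        by_cases hz : ‖z‖ < φ.rOut
        · exact mul_le_mul_right (h z hz) _
        · have : z ∉ Function.support (φ.normed volume) := by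
            rwa [φ.support_normed_eq, mem_ball_zero_iff]
          simp [Function.notMem_support.1 this]
    _ = c := by
        rw [lintegral_mul_const _ φ.continuous_normed.measurable.ennreal_ofReal,
          lintegral_ofReal_normed, one_mul]

lemma ofReal_integral_le_lintegral {α : Type*} [MeasurableSpace α] {μ : Measure α} {f : α → ℝ}
    (hf : Integrable f μ) : ENNReal.ofReal (∫ x, f x ∂μ) ≤ ∫⁻ x, ENNReal.ofReal (f x) ∂μ := by
  have h1 : ∫ x, f x ∂μ ≤ ∫ x, max (f x) 0 ∂μ :=
    integral_mono hf hf.pos_part fun x => le_max_left _ _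
  refine (ENNReal.ofReal_le_ofReal h1).trans ?_
  rw [ofReal_integral_eq_lintegral_ofReal hf.pos_part (ae_of_all _ fun x => le_max_right _ _)]
  refine (lintegral_congr fun x => ?_).le
  simp

lemma ofReal_mollify_sub_le {n : ℕ} (φ : ContDiffBump (0 : Euc n)) {w : Euc n → ℝ}
    (hw : Measurable w) (hw1 : ∀ x, |w x| ≤ 1) (x y : Euc n) :
    ENNReal.ofReal (mollify φ w x - mollify φ w y) ≤
      ∫⁻ z, ENNReal.ofReal (φ.normed volume z) * ENNReal.ofReal (w (x - z) - w (y - z)) := by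
  rw [mollify_apply, mollify_apply, ← integral_sub (integrable_normed_mul φ hw hw1 x)
    (integrable_normed_mul φ hw hw1 y)]
  refine (ofReal_integral_le_lintegral ((integrable_normed_mul φ hw hw1 x).sub
    (integrable_normed_mul φ hw hw1 y))).trans (lintegral_congr fun z => ?_).le
  rw [← ENNReal.ofReal_mul (φ.nonneg_normed z), mul_sub]
  rfl

lemma enorm_mollify_sub_le {n : ℕ} (φ : ContDiffBump (0 : Euc n)) {w : Euc n → ℝ}
    (hw : Measurable w) (hw1 : ∀ x, |w x| ≤ 1) (x : Euc n) :
    ‖mollify φ w x - w x‖ₑ ≤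
      ∫⁻ z, ENNReal.ofReal (φ.normed volume z) * ‖w (x - z) - w x‖ₑ := by
  have h : w x = ∫ z, φ.normed volume z * w x := by
    rw [integral_mul_const, φ.integral_normed, one_mul]
  conv_lhs => rw [mollify_apply, h, ← integral_sub (integrable_normed_mul φ hw hw1 x)
    (φ.integrable_normed.mul_const _)]
  refine (enorm_integral_le_lintegral_enorm _).trans (lintegral_congr fun z => ?_).le
  rw [← mul_sub, enorm_mul, Real.enorm_of_nonneg (φ.nonneg_normed z)]

/-- The mollification is an average of translates by vectors shorter than `δ`. The functional is
convex, and each translate has variation in `Ω` at most that of `w` in the `δ`-thickening. -/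
lemma fracVariation_mollify_le {n : ℕ} {s : ℝ} (hs : 0 ≤ s) {φ : ContDiffBump (0 : Euc n)}
    {w : Euc n → ℝ} (hw : Measurable w) (hw1 : ∀ x, |w x| ≤ 1) {Ω : Set (Euc n)} {δ : ℝ}
    (hδ : φ.rOut ≤ δ) :
    fracVariation s (mollify φ w) Ω ≤ fracVariation s w (Metric.thickening δ Ω) := by
  have hφ := φ.continuous_normed (μ := volume) |>.measurable
  have hk := measurable_fracKernel (n := n) s
  calc fracVariation s (mollify φ w) Ω
      ≤ ∫⁻ p in touching Ω, ∫⁻ z, fracKernel s p * (ENNReal.ofReal (φ.normed volume z)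
          * ENNReal.ofReal (w (p.1 - z) - w (p.2 - z))) := by
        refine lintegral_mono fun p => ?_
        rw [lintegral_const_mul _ (by fun_prop)]
        exact mul_le_mul_right (ofReal_mollify_sub_le φ hw hw1 p.1 p.2) _
    _ = ∫⁻ z, ∫⁻ p in touching Ω, fracKernel s p * (ENNReal.ofReal (φ.normed volume z)
          * ENNReal.ofReal (w (p.1 - z) - w (p.2 - z))) :=
        lintegral_lintegral_swap (by unfold Function.uncurry; fun_prop)
    _ = ∫⁻ z, ENNReal.ofReal (φ.normed volume z) * fracVariation s (w ∘ fun x => x - z) Ω := by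
        refine lintegral_congr fun z => ?_
        rw [fracVariation, ← lintegral_const_mul' _ _ ENNReal.ofReal_ne_top]
        refine lintegral_congr fun p => ?_
        rw [mul_left_comm]
        rfl
    _ ≤ fracVariation s w (Metric.thickening δ Ω) := by
        refine lintegral_ofReal_normed_mul_le fun z hz => ?_
        have := fracVariation_comp_le hs one_pos (Φ := fun x => x - z)
          (IsometryEquiv.subRight z).isometry.lipschitz
          (IsometryEquiv.subRight z).isometry.antilipschitz
          (Metric.isOpen_thickening (δ := δ) (E := Ω)).measurableSet (Ω' := Ω) (fun x hx => by
            rw [Metric.mem_thickening_iff]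
            exact ⟨x, hx, by simpa [dist_eq_norm] using hz.trans_le hδ⟩) hw
        simpa using this

lemma exists_lintegral_mollify_sub_le {n : ℕ} {w : Euc n → ℝ} (hw : Measurable w)
    (hw1 : ∀ x, |w x| ≤ 1) (hwi : LocallyIntegrable w) (R : ℝ) {η : ℝ≥0∞} (hη : η ≠ 0)
    {δ : ℝ} (hδ : 0 < δ) :
    ∃ φ : ContDiffBump (0 : Euc n), φ.rOut ≤ δ ∧
      ∫⁻ x in Metric.ball 0 R, ‖mollify φ w x - w x‖ₑ ≤ η := by
  obtain ⟨ε, hε, h⟩ := exists_lintegral_comp_sub_le hw hwi R 1 hη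
  have hm : 0 < min ε δ := lt_min hε hδ
  let φ : ContDiffBump (0 : Euc n) := ⟨min ε δ / 2, min ε δ, by positivity, by linarith⟩
  have hφ := φ.continuous_normed (μ := volume) |>.measurable
  refine ⟨φ, min_le_right _ _, ?_⟩
  calc ∫⁻ x in Metric.ball 0 R, ‖mollify φ w x - w x‖ₑ
      ≤ ∫⁻ x in Metric.ball (0 : Euc n) R,
          ∫⁻ z, ENNReal.ofReal (φ.normed volume z) * ‖w (x - z) - w x‖ₑ :=
        lintegral_mono fun x => enorm_mollify_sub_le φ hw hw1 x
    _ = ∫⁻ z, ∫⁻ x in Metric.ball (0 : Euc n) R,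
          ENNReal.ofReal (φ.normed volume z) * ‖w (x - z) - w x‖ₑ :=
        lintegral_lintegral_swap (by unfold Function.uncurry; fun_prop)
    _ = ∫⁻ z, ENNReal.ofReal (φ.normed volume z) *
          ∫⁻ x in Metric.ball (0 : Euc n) R, ‖w (x - z) - w x‖ₑ :=
        lintegral_congr fun z => lintegral_const_mul' _ _ ENNReal.ofReal_ne_top
    _ ≤ η := by
        refine lintegral_ofReal_normed_mul_le fun z hz => ?_
        refine h (fun x => x - z) (by fun_prop)
          (IsometryEquiv.subRight z).isometry.antilipschitz fun x => ?_
        rw [dist_eq_norm, sub_sub_cancel_left, norm_neg]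
        exact hz.le.trans (min_le_left _ _)

/-! ### Perturbation to countably many critical points -/

lemma Set.Countable.of_eventually_notMem {X : Type*} [TopologicalSpace X]
    [SecondCountableTopology X] {S : Set X} (h : ∀ x ∈ S, ∀ᶠ z in 𝓝[≠] x, z ∉ S) :
    S.Countable := by
  have hd : DiscreteTopology S := by
    rw [discreteTopology_subtype_iff]
    intro x hx
    rw [← disjoint_iff, Filter.disjoint_principal_right]
    exact h x hx
  exact Set.countable_coe_iff.1 (TopologicalSpace.separableSpace_iff_countable.1 inferInstance)

/-- Arbitrarily small linear perturbations of a smooth function have countably many critical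
points. -/
lemma ContDiff.exists_countable_setOf_fderiv_eq {n : ℕ} {u : Euc n → ℝ} (hu : ContDiff ℝ ∞ u)
    {ε : ℝ} (hε : 0 < ε) :
    ∃ ℓ : Euc n →L[ℝ] ℝ, ‖ℓ‖ < ε ∧ {x | fderiv ℝ u x = ℓ}.Countable := by
  have hfin : Module.finrank ℝ (Euc n) = Module.finrank ℝ (Euc n →L[ℝ] ℝ) := by
    rw [← (LinearMap.toContinuousLinearMap (𝕜 := ℝ) (E := Euc n) (F' := ℝ)).finrank_eq]
    exact (Subspace.dual_finrank_eq).symm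
  -- Identifying the dual with the space turns the differential of `u` into a self-map `G`, to which
  -- the equidimensional Sard theorem applies.
  let Θ : Euc n ≃L[ℝ] (Euc n →L[ℝ] ℝ) := ContinuousLinearEquiv.ofFinrankEq hfin
  let G : Euc n → Euc n := fun x => Θ.symm (fderiv ℝ u x)
  have hG : Differentiable ℝ G := Θ.symm.differentiable.comp
    ((hu.fderiv_right (m := 1) (by norm_cast)).differentiable one_ne_zero)
  have hnull : volume (G '' {x | (fderiv ℝ G x).det = 0}) = 0 :=
    addHaar_image_eq_zero_of_det_fderivWithin_eq_zero volume
      (fun x _ => (hG x).hasFDerivAt.hasFDerivWithinAt) fun x hx => hx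
  have hopen : IsOpen {a : Euc n | ‖Θ a‖ < ε} :=
    isOpen_lt (Θ.continuous.norm) continuous_const
  obtain ⟨a, ha, haG⟩ : ∃ a ∈ {a : Euc n | ‖Θ a‖ < ε}, a ∉ G '' {x | (fderiv ℝ G x).det = 0} := by
    by_contra! hcon
    exact (hopen.measure_pos volume ⟨0, by simpa using hε⟩).ne'
      (measure_mono_null hcon hnull)
  refine ⟨Θ a, ha, ?_⟩
  have hset : {x | fderiv ℝ u x = Θ a} = {x | G x = a} := by
    ext x
    exact (Θ.symm_apply_eq (x := fderiv ℝ u x) (y := a)).symm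
  rw [hset]
  refine Set.Countable.of_eventually_notMem fun x hx => ?_
  -- Since `a` is a regular value of `G`, the derivative is invertible at each solution of `G x =
  -- a`, so the solutions are isolated.
  have hdet : (fderiv ℝ G x).det ≠ 0 := fun h => haG ⟨x, h, hx⟩
  exact (hG x).hasFDerivAt.eventually_ne
    ⟨_, ((fderiv ℝ G x).toContinuousLinearEquivOfDetNeZero hdet).antilipschitz⟩

/-! ### The cost of a linear perturbation -/

/-- The radial integrand is `r^{-s}` on `(0, 1]`, integrable since `s < 1`, and `r^{-1-s}` beyond 1,
integrable since `s > 0`. -/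
lemma integrableOn_pow_mul_min_mul_rpow {s : ℝ} (hs0 : 0 < s) (hs1 : s < 1) {n : ℕ} (hn : n ≠ 0) :
    IntegrableOn (fun r : ℝ => r ^ (n - 1) • (min 1 r * r ^ (-((n : ℝ) + s)))) (Set.Ioi 0) := by
  have hpow : ∀ r : ℝ, 0 < r → r ^ (n - 1) * r ^ (-((n : ℝ) + s)) = r ^ (-1 - s) := fun r hr => by
    rw [← Real.rpow_natCast, ← Real.rpow_add hr, Nat.cast_pred (Nat.pos_of_ne_zero hn)]
    congr 1
    ring
  rw [← Set.Ioc_union_Ioi_eq_Ioi zero_le_one, integrableOn_union]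
  constructor
  · have h := (intervalIntegral.intervalIntegrable_rpow' (a := 0) (b := 1) (r := -s)
      (by linarith)).1
    refine h.congr_fun (fun r hr => ?_) measurableSet_Ioc
    simp only [smul_eq_mul]
    rw [min_eq_right hr.2, mul_left_comm, hpow r hr.1, ← Real.rpow_one_add' hr.1.le (by linarith)]
    congr 1
    ring
  · have h := integrableOn_Ioi_rpow_of_lt (a := -1 - s) (by linarith) one_pos
    refine h.congr_fun (fun r hr => ?_) measurableSet_Ioi
    simp only [smul_eq_mul]
    rw [min_eq_left (le_of_lt hr), one_mul, hpow r (one_pos.trans hr)]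

lemma lintegral_kernel_mul_min_lt_top {s : ℝ} (hs0 : 0 < s) (hs1 : s < 1) {n : ℕ} (hn : n ≠ 0) :
    ∫⁻ z : Euc n, 1 / ENNReal.ofReal (‖z‖ ^ ((n : ℝ) + s)) * ENNReal.ofReal (min 1 ‖z‖) < ⊤ := by
  have : Nonempty (Fin n) := ⟨⟨0, Nat.pos_of_ne_zero hn⟩⟩
  have hint : Integrable (fun z : Euc n => min 1 ‖z‖ * ‖z‖ ^ (-((n : ℝ) + s))) := by
    rw [integrable_fun_norm_addHaar volume (f := fun r => min 1 r * r ^ (-((n : ℝ) + s)))]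
    simpa using integrableOn_pow_mul_min_mul_rpow hs0 hs1 hn
  refine lt_of_le_of_lt (lintegral_mono fun z => ?_) hint.lintegral_lt_top
  rcases eq_or_ne z 0 with rfl | hz
  · simp
  · have hz' : 0 < ‖z‖ := norm_pos_iff.2 hz
    rw [one_div, ← ENNReal.ofReal_inv_of_pos (by positivity), ← Real.rpow_neg hz'.le,
      ← ENNReal.ofReal_mul (by positivity), mul_comm]

/-- Dominated convergence as `ε → 0⁺`, with the integrand at `ε = 1` as majorant. -/
lemma exists_lintegral_kernel_mul_min_le {s : ℝ} (hs0 : 0 < s) (hs1 : s < 1) {n : ℕ} (hn : n ≠ 0)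
    {η : ℝ≥0∞} (hη : η ≠ 0) :
    ∃ ε₀ > 0, ∀ ε > 0, ε ≤ ε₀ → ∫⁻ z : Euc n,
      1 / ENNReal.ofReal (‖z‖ ^ ((n : ℝ) + s)) * ENNReal.ofReal (min 1 (ε * ‖z‖)) ≤ η := by
  have hlim : Tendsto (fun ε : ℝ => ∫⁻ z : Euc n,
      1 / ENNReal.ofReal (‖z‖ ^ ((n : ℝ) + s)) * ENNReal.ofReal (min 1 (ε * ‖z‖)))
      (𝓝[>] 0) (𝓝 (∫⁻ _ : Euc n, 0)) := by
    refine tendsto_lintegral_filter_of_dominated_convergence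
      (fun z => 1 / ENNReal.ofReal (‖z‖ ^ ((n : ℝ) + s)) * ENNReal.ofReal (min 1 ‖z‖))
      (Eventually.of_forall fun ε => by fun_prop) ?_
      (lintegral_kernel_mul_min_lt_top hs0 hs1 hn).ne (ae_of_all _ fun z => ?_)
    · filter_upwards [Ioc_mem_nhdsGT (zero_lt_one' ℝ)] with ε hε
      refine ae_of_all _ fun z => ?_
      gcongr
      exact mul_le_of_le_one_left (norm_nonneg z) hε.2
    · rcases eq_or_ne z 0 with rfl | hz
      · simp
      · have hz' : 0 < ‖z‖ := norm_pos_iff.2 hz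
        have h0 : Tendsto (fun ε : ℝ => min 1 (ε * ‖z‖)) (𝓝[>] 0) (𝓝 (min 1 (0 * ‖z‖))) :=
          (Continuous.tendsto (by fun_prop) 0).mono_left nhdsWithin_le_nhds
        have hk : 1 / ENNReal.ofReal (‖z‖ ^ ((n : ℝ) + s)) ≠ ⊤ := by
          simp only [one_div, ne_eq, ENNReal.inv_eq_top, ENNReal.ofReal_eq_zero, not_le]
          positivity
        simpa using ENNReal.Tendsto.const_mul (ENNReal.tendsto_ofReal h0) (Or.inr hk)
  rw [lintegral_zero] at hlim
  obtain ⟨ε₀, hε₀, h⟩ := mem_nhdsGT_iff_exists_Ioc_subset.1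
    (hlim.eventually (ge_mem_nhds hη.bot_lt))
  exact ⟨ε₀, hε₀, fun ε hε hle => h ⟨hε, hle⟩⟩

lemma setLIntegral_touching_le {n : ℕ} {s : ℝ} (Ω : Set (Euc n)) (ε : ℝ) :
    ∫⁻ p in touching Ω, fracKernel s p * ENNReal.ofReal (min 1 (ε * ‖p.1 - p.2‖)) ≤
      2 * volume Ω * ∫⁻ z : Euc n,
        1 / ENNReal.ofReal (‖z‖ ^ ((n : ℝ) + s)) * ENNReal.ofReal (min 1 (ε * ‖z‖)) := by
  set κ : Euc n → ℝ≥0∞ := fun z =>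
    1 / ENNReal.ofReal (‖z‖ ^ ((n : ℝ) + s)) * ENNReal.ofReal (min 1 (ε * ‖z‖)) with hκ
  have hκm : Measurable κ := by fun_prop
  have hκ2 : Measurable fun p : Euc n × Euc n => κ (p.1 - p.2) := by fun_prop
  have hT : touching Ω = Ω ×ˢ Set.univ ∪ Set.univ ×ˢ Ω := by
    ext p
    simp [touching]
  have h1 : ∫⁻ p in Ω ×ˢ Set.univ, κ (p.1 - p.2) = volume Ω * ∫⁻ z, κ z := by
    rw [Measure.volume_eq_prod, ← Measure.prod_restrict, Measure.restrict_univ,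
      lintegral_prod _ hκ2.aemeasurable]
    simp only
    rw [lintegral_congr fun x => lintegral_sub_left_eq_self κ x, lintegral_const, mul_comm]
    simp
  have h2 : ∫⁻ p in Set.univ ×ˢ Ω, κ (p.1 - p.2) = volume Ω * ∫⁻ z, κ z := by
    rw [Measure.volume_eq_prod, ← Measure.prod_restrict, Measure.restrict_univ,
      lintegral_prod_symm _ hκ2.aemeasurable]
    simp only
    rw [lintegral_congr fun x => lintegral_sub_right_eq_self κ x, lintegral_const, mul_comm]
    simp
  calc ∫⁻ p in touching Ω, κ (p.1 - p.2)
      ≤ (∫⁻ p in Ω ×ˢ Set.univ, κ (p.1 - p.2)) + ∫⁻ p in Set.univ ×ˢ Ω, κ (p.1 - p.2) := by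
        rw [hT]
        exact lintegral_union_le _ _ _
    _ = 2 * volume Ω * ∫⁻ z, κ z := by
        rw [h1, h2]
        ring

/-- Truncation of a real function to the unit interval. -/
def clip (t : ℝ) : ℝ := max 0 (min 1 t)

/-- Truncation is monotone and 1-Lipschitz, and its increments never exceed 1. The resulting cap on
`d` is what makes the contribution of a linear function integrable at infinity. -/
lemma clip_sub_clip_le {a b a' b' d : ℝ} (h : a - b ≤ a' - b' + d) (hd : 0 ≤ d) :
    clip a - clip b ≤ max (a' - b') 0 + min 1 d := by
  have h1 : clip a ≤ 1 := max_le zero_le_one (min_le_left _ _)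
  have h2 : 0 ≤ clip b := le_max_left _ _
  have h3 : clip a - clip b ≤ max (a - b) 0 := by
    unfold clip
    simp only [max_def, min_def]
    split_ifs <;> linarith
  rcases le_total 1 d with hd1 | hd1
  · rw [min_eq_left hd1]
    linarith [le_max_right (a' - b') 0]
  · rw [min_eq_right hd1]
    refine h3.trans (max_le ?_ ?_)
    · linarith [le_max_left (a' - b') 0]
    · linarith [le_max_right (a' - b') 0]

lemma fracVariation_clip_sub_le {n : ℕ} (s : ℝ) {u : Euc n → ℝ} (hu : Measurable u)
    (ℓ : Euc n →L[ℝ] ℝ) {ε : ℝ} (hℓ : ‖ℓ‖ ≤ ε) (Ω : Set (Euc n)) :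
    fracVariation s (fun x => clip (u x - ℓ x)) Ω ≤ fracVariation s u Ω +
      ∫⁻ p in touching Ω, fracKernel s p * ENNReal.ofReal (min 1 (ε * ‖p.1 - p.2‖)) := by
  have hk := measurable_fracKernel (n := n) s
  have hε : 0 ≤ ε := (norm_nonneg ℓ).trans hℓ
  unfold fracVariation
  rw [← lintegral_add_left (by fun_prop)]
  refine lintegral_mono fun p => ?_
  rw [← mul_add]
  refine mul_le_mul_right ?_ _
  have h1 : u p.1 - ℓ p.1 - (u p.2 - ℓ p.2) ≤ u p.1 - u p.2 + ε * ‖p.1 - p.2‖ := by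
    have := (neg_abs_le (ℓ (p.1 - p.2)))
    have h2 : |ℓ (p.1 - p.2)| ≤ ε * ‖p.1 - p.2‖ := ℓ.le_of_opNorm_le hℓ _
    rw [map_sub] at this h2
    linarith
  refine (ENNReal.ofReal_le_ofReal (clip_sub_clip_le h1 (by positivity))).trans ?_
  refine ENNReal.ofReal_add_le.trans (add_le_add (le_of_eq ?_) le_rfl)
  simp

/-! ### Superlevel sets and the coarea inequality -/

lemma clip_mono : Monotone clip := fun _ _ h => max_le_max_left _ (min_le_min_left _ h)

lemma clip_of_mem {t : ℝ} (h0 : 0 ≤ t) (h1 : t ≤ 1) : clip t = t := by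
  rw [clip, min_eq_right h1, max_eq_right h0]

lemma measurableSet_superlevel {n : ℕ} {u : Euc n → ℝ} (hu : Measurable u) :
    MeasurableSet {q : ℝ × (Euc n × Euc n) | u q.2.2 ≤ q.1 ∧ q.1 < u q.2.1} :=
  MeasurableSet.inter
    (measurableSet_le (f := fun q : ℝ × (Euc n × Euc n) => u q.2.2) (by fun_prop) measurable_fst)
    (measurableSet_lt (g := fun q : ℝ × (Euc n × Euc n) => u q.2.1) measurable_fst (by fun_prop))

/-- This form has an integrand jointly measurable in `(t, p)`, ready for Tonelli. -/
lemma fracPerimeter_superlevel {n : ℕ} (s : ℝ) {u : Euc n → ℝ} (hu : Measurable u)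
    {Ω : Set (Euc n)} (hΩ : MeasurableSet Ω) (t : ℝ) :
    fracPerimeter s {x | t < u x} Ω = ∫⁻ p in touching Ω,
      {q : ℝ × (Euc n × Euc n) | u q.2.2 ≤ q.1 ∧ q.1 < u q.2.1}.indicator
        (fun q => fracKernel s q.2) (t, p) := by
  have hF : MeasurableSet {x | t < u x} := measurableSet_lt measurable_const hu
  rw [fracPerimeter_eq_lintegral s hF hΩ, Set.inter_comm,
    ← Measure.restrict_restrict (hF.prod hF.compl), ← lintegral_indicator (hF.prod hF.compl)]
  refine lintegral_congr fun p => ?_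
  simp only [Set.indicator, Set.mem_prod, Set.mem_compl_iff, Set.mem_ofPred_eq, not_lt, and_comm]

lemma measurable_fracPerimeter_superlevel {n : ℕ} (s : ℝ) {u : Euc n → ℝ} (hu : Measurable u)
    {Ω : Set (Euc n)} (hΩ : MeasurableSet Ω) :
    Measurable fun t => fracPerimeter s {x | t < u x} Ω := by
  simp_rw [fracPerimeter_superlevel s hu hΩ]
  exact (((measurable_fracKernel s).comp measurable_snd).indicator
    (measurableSet_superlevel hu)).lintegral_prod_right'

/-- The inequality in the coarea formula. -/
lemma lintegral_fracPerimeter_superlevel_le {n : ℕ} (s : ℝ) {u : Euc n → ℝ} (hu : Measurable u)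
    {Ω : Set (Euc n)} (hΩ : MeasurableSet Ω) :
    ∫⁻ t in Set.Ioo (0 : ℝ) 1, fracPerimeter s {x | t < u x} Ω
      ≤ fracVariation s (fun x => clip (u x)) Ω := by
  simp_rw [fracPerimeter_superlevel s hu hΩ]
  have hm : Measurable ({q : ℝ × (Euc n × Euc n) | u q.2.2 ≤ q.1 ∧ q.1 < u q.2.1}.indicator
      fun q => fracKernel s q.2) :=
    ((measurable_fracKernel s).comp measurable_snd).indicator (measurableSet_superlevel hu)
  refine (lintegral_lintegral_swap (f := fun (t : ℝ) (p : Euc n × Euc n) =>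
    {q : ℝ × (Euc n × Euc n) | u q.2.2 ≤ q.1 ∧ q.1 < u q.2.1}.indicator
      (fun q => fracKernel s q.2) (t, p)) hm.aemeasurable).trans_le ?_
  refine lintegral_mono fun p => ?_
  calc ∫⁻ t in Set.Ioo (0 : ℝ) 1,
        {q : ℝ × (Euc n × Euc n) | u q.2.2 ≤ q.1 ∧ q.1 < u q.2.1}.indicator
          (fun q => fracKernel s q.2) (t, p)
      = ∫⁻ t in Set.Ioo (0 : ℝ) 1,
          (Set.Ico (u p.2) (u p.1)).indicator (fun _ => fracKernel s p) t := rfl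
    _ = fracKernel s p * volume (Set.Ico (u p.2) (u p.1) ∩ Set.Ioo 0 1) := by
        rw [lintegral_indicator_const measurableSet_Ico, Measure.restrict_apply measurableSet_Ico]
    -- A level `t ∈ (0, 1)` is fixed by the monotone map `clip`, so it stays between the truncated
    -- values.
    _ ≤ fracKernel s p * volume (Set.Icc (clip (u p.2)) (clip (u p.1))) := by
        gcongr
        rintro t ⟨⟨h1, h2⟩, h3, h4⟩
        rw [← clip_of_mem h3.le h4.le]
        exact ⟨clip_mono h1, clip_mono h2.le⟩
    _ = fracKernel s p * ENNReal.ofReal (clip (u p.1) - clip (u p.2)) := by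
        rw [Real.volume_Icc]

lemma hasSmoothBoundary_superlevel {n : ℕ} {u : Euc n → ℝ} (hu : ContDiff ℝ ∞ u) {t : ℝ}
    (ht : ∀ x, u x = t → fderiv ℝ u x ≠ 0) : HasSmoothBoundary {x | t < u x} := by
  intro x hx
  have hxt : t = u x := frontier_lt_subset_eq continuous_const hu.continuous hx
  refine ⟨Set.univ, isOpen_univ, Set.mem_univ x, fun y => t - u y,
    (contDiff_const.sub hu).contDiffOn, ?_, ?_⟩
  · rw [fderiv_const_sub]
    exact neg_ne_zero.2 (ht x hxt.symm)
  · ext y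
    simp

/-- Chebyshev: on the symmetric difference either `u > t` where the indicator is 0, or `u ≤ t` where
it is 1, so the two functions differ by at least `min t (1 - t)`. -/
lemma volume_symmDiff_superlevel_inter_le {n : ℕ} {u : Euc n → ℝ} (hu : Measurable u)
    {E : Set (Euc n)} (hE : MeasurableSet E) (t : ℝ) (B : Set (Euc n)) :
    ENNReal.ofReal (min t (1 - t)) * volume (symmDiff {x | t < u x} E ∩ B) ≤
      ∫⁻ x in B, ‖u x - E.indicator 1 x‖ₑ := by
  have hm : Measurable fun x => ‖u x - E.indicator (1 : Euc n → ℝ) x‖ₑ :=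
    (hu.sub (measurable_one.indicator hE)).enorm
  refine le_trans ?_ (mul_meas_ge_le_lintegral hm (ENNReal.ofReal (min t (1 - t))))
  rw [Measure.restrict_apply (measurableSet_le measurable_const hm)]
  gcongr
  intro x hx
  change ENNReal.ofReal (min t (1 - t)) ≤ ‖u x - E.indicator (1 : Euc n → ℝ) x‖ₑ
  rw [← ofReal_norm, Real.norm_eq_abs]
  refine ENNReal.ofReal_le_ofReal ?_
  rcases hx with ⟨h1, h2⟩ | ⟨h1, h2⟩
  · rw [Set.indicator_of_notMem h2, sub_zero]
    exact (min_le_left _ _).trans ((le_of_lt h1).trans (le_abs_self _))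
  · rw [Set.indicator_of_mem h1, abs_sub_comm]
    have h3 : u x ≤ t := not_lt.1 h2
    exact (min_le_right _ _).trans ((sub_le_sub_left h3 1).trans (le_abs_self _))

lemma convergesLocally_superlevel {n : ℕ} {u : ℕ → Euc n → ℝ} (hu : ∀ k, Measurable (u k))
    {E : Set (Euc n)} (hE : MeasurableSet E) {t : ℝ} (ht : t ∈ Set.Ioo (0 : ℝ) 1) {η : ℕ → ℝ≥0∞}
    (hη : Tendsto η atTop (𝓝 0))
    (h : ∀ k : ℕ, ∫⁻ x in Metric.ball (0 : Euc n) k, ‖u k x - E.indicator 1 x‖ₑ ≤ η k) :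
    ConvergesLocally (fun k => {x | t < u k x}) E := by
  intro U _ hU
  obtain ⟨R, hR⟩ := hU.subset_ball 0
  obtain ⟨N, hN⟩ := exists_nat_gt R
  have hc : 0 < min t (1 - t) := lt_min ht.1 (by linarith [ht.2])
  have hc0 : ENNReal.ofReal (min t (1 - t)) ≠ 0 := by
    rw [Ne, ENNReal.ofReal_eq_zero, not_le]
    exact hc
  have hlim : Tendsto (fun k => (ENNReal.ofReal (min t (1 - t)))⁻¹ * η k) atTop (𝓝 0) := by
    simpa using ENNReal.Tendsto.const_mul hη (Or.inr (ENNReal.inv_ne_top.2 hc0))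
  refine tendsto_of_tendsto_of_tendsto_of_le_of_le' tendsto_const_nhds hlim
    (Eventually.of_forall fun _ => zero_le) ?_
  filter_upwards [eventually_ge_atTop N] with k hk
  have hsub : U ⊆ Metric.ball 0 k := hR.trans
    (Metric.ball_subset_ball (hN.le.trans (by exact_mod_cast hk)))
  have := (volume_symmDiff_superlevel_inter_le (hu k) hE t _).trans (h k)
  rw [mul_comm, ← div_eq_mul_inv, ENNReal.le_div_iff_mul_le (Or.inl hc0)
    (Or.inl ENNReal.ofReal_ne_top), mul_comm]
  refine le_trans ?_ this
  gcongr

/-! ### Construction of the approximating sets -/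

lemma tendsto_distortion {n : ℕ} (s : ℝ) (P : ℝ≥0∞) :
    Tendsto (fun ε : NNReal => ENNReal.ofReal (((1 + ε : NNReal) : ℝ) ^ ((n : ℝ) + s)) *
      (((1 + ε : NNReal) : ℝ≥0∞) ^ n * ((1 + ε : NNReal) : ℝ≥0∞) ^ n) * P) (𝓝 0) (𝓝 P) := by
  have h1 : Tendsto (fun ε : NNReal => ENNReal.ofReal (((1 + ε : NNReal) : ℝ) ^ ((n : ℝ) + s)))
      (𝓝 0) (𝓝 1) := by
    have : ContinuousAt
        (fun ε : NNReal => ENNReal.ofReal (((1 + ε : NNReal) : ℝ) ^ ((n : ℝ) + s))) 0 :=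
      ENNReal.continuous_ofReal.continuousAt.comp
        (ContinuousAt.rpow_const (by fun_prop) (Or.inl (by simp)))
    simpa [ContinuousAt] using this
  have h2 : Tendsto (fun ε : NNReal => ((1 + ε : NNReal) : ℝ≥0∞) ^ n) (𝓝 0) (𝓝 1) := by
    have : Continuous (fun ε : NNReal => ((1 + ε : NNReal) : ℝ≥0∞) ^ n) := by fun_prop
    simpa using this.tendsto 0
  have h3 := ENNReal.Tendsto.mul h2 (Or.inl one_ne_zero) h2 (Or.inl one_ne_zero)
  rw [one_mul] at h3
  have h4 := ENNReal.Tendsto.mul h1 (Or.inl one_ne_zero) h3 (Or.inl one_ne_zero)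
  rw [one_mul] at h4
  simpa using ENNReal.Tendsto.mul h4 (Or.inl one_ne_zero)
    (tendsto_const_nhds (x := P)) (Or.inr ENNReal.one_ne_top)

/-- Smooth approximation with small increase of the fractional variation and countably many
critical points. -/
lemma exists_contDiff_approx {n : ℕ} (hn : n ≠ 0) {s : ℝ} (hs0 : 0 < s) (hs1 : s < 1)
    {Ω : Set (Euc n)} (hopen : IsOpen Ω) (hb : Bornology.IsBounded Ω)
    (hΩ : HasLipschitzBoundary Ω) {E : Set (Euc n)} (hE : MeasurableSet E)
    (hP : fracPerimeter s E Ω ≠ ⊤) {η : ℝ≥0∞} (hη : η ≠ 0) (R : ℝ) :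
    ∃ u : Euc n → ℝ, ContDiff ℝ ∞ u ∧ {x | fderiv ℝ u x = 0}.Countable ∧
      fracVariation s (fun x => clip (u x)) Ω ≤ fracPerimeter s E Ω + η ∧
      ∫⁻ x in Metric.ball (0 : Euc n) R, ‖u x - E.indicator 1 x‖ₑ ≤ η := by
  set χ : Euc n → ℝ := E.indicator 1 with hχ
  have hχm : Measurable χ := measurable_one.indicator hE
  have hχ1 : ∀ x, |χ x| ≤ 1 := fun x => by
    by_cases hx : x ∈ E <;> simp [hχ, hx]
  have hbdd : ∀ w : Euc n → ℝ, Measurable w → (∀ x, |w x| ≤ 1) → LocallyIntegrable w :=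
    fun w hw hw1 => (locallyIntegrable_const (1 : ℝ)).mono hw.aestronglyMeasurable
      (ae_of_all _ fun x => by simpa using hw1 x)
  have hη3 : η / 3 ≠ 0 := by simp [ENNReal.div_eq_zero_iff, hη]
  have hη2 : η / 2 ≠ 0 := by simp [ENNReal.div_eq_zero_iff, hη]
  have hvol : volume Ω ≠ ⊤ := hb.measure_lt_top.ne
  -- The antilipschitz constant is fixed at 2, which bounds `1 + ε` for every `ε ≤ 1`, so that `ε`
  -- can be chosen after `ε₁`.
  obtain ⟨ε₁, hε₁, hclose⟩ := exists_lintegral_comp_sub_le hχm (hbdd χ hχm hχ1) R 2 hη3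
  obtain ⟨ε, hε0, hεle, hε1, hdist⟩ : ∃ ε : NNReal, 0 < ε ∧ (ε : ℝ) ≤ ε₁ ∧ ε ≤ 1 ∧
      ENNReal.ofReal (((1 + ε : NNReal) : ℝ) ^ ((n : ℝ) + s)) *
        (((1 + ε : NNReal) : ℝ≥0∞) ^ n * ((1 + ε : NNReal) : ℝ≥0∞) ^ n) * fracPerimeter s E Ω
        ≤ fracPerimeter s E Ω + η / 2 := by
    have h1 := (tendsto_distortion (n := n) s _).eventually
      (ge_mem_nhds (ENNReal.lt_add_right hP hη2))
    have h2 : ∀ᶠ ε : NNReal in 𝓝 0, ε < min 1 ⟨ε₁, hε₁.le⟩ :=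
      gt_mem_nhds (lt_min one_pos hε₁)
    obtain ⟨ε, ⟨hε, hε'⟩, hpos⟩ := (((h1.and h2).filter_mono
      (nhdsWithin_le_nhds (s := Set.Ioi 0))).and self_mem_nhdsWithin).exists
    exact ⟨ε, hpos, (hε'.trans_le (min_le_right _ _)).le, (hε'.trans_le (min_le_left _ _)).le, hε⟩
  obtain ⟨Φ, hL, hA, hΦ, δ, hδ, hmaps⟩ := hΩ.exists_mapsTo_thickening hopen hb hε0
  have hΦm : Measurable Φ := hL.continuous.measurable
  have hw : Measurable (χ ∘ Φ) := hχm.comp hΦm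
  have hw1 : ∀ x, |(χ ∘ Φ) x| ≤ 1 := fun x => hχ1 _
  have hstep1 : ∫⁻ x in Metric.ball (0 : Euc n) R, ‖(χ ∘ Φ) x - χ x‖ₑ ≤ η / 3 :=
    hclose Φ hL.continuous (fun x y => (hA x y).trans (by
      gcongr
      rw [← one_add_one_eq_two]
      gcongr)) fun x => (hΦ x).trans hεle
  obtain ⟨φ, hφ, hstep2⟩ := exists_lintegral_mollify_sub_le hw hw1 (hbdd _ hw hw1) R hη3 hδ
  set v := mollify φ (χ ∘ Φ) with hv
  have hvsm : ContDiff ℝ ∞ v := contDiff_mollify φ (hbdd _ hw hw1)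
  have hvar : fracVariation s v Ω ≤ fracPerimeter s E Ω + η / 2 := by
    refine (fracVariation_mollify_le hs0.le hw hw1 hφ).trans (le_trans ?_ hdist)
    rw [fracPerimeter_eq_fracVariation s hE hopen.measurableSet]
    exact fracVariation_comp_le hs0.le (by positivity) hL hA hopen.measurableSet hmaps hχm
  -- The variation budget is `η / 2` for distortion and `η / 2` for the linear term; the factor `2 *
  -- volume Ω` comes from `setLIntegral_touching_le`. Below, `θ` keeps `ℓ` within the last third of
  -- the `L¹` budget on the ball.
  obtain ⟨ε₂, hε₂, hker⟩ := exists_lintegral_kernel_mul_min_le hs0 hs1 hn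
    (η := η / 2 / (2 * volume Ω)) (by
      rw [Ne, ENNReal.div_eq_zero_iff, not_or]
      exact ⟨hη2, ENNReal.mul_ne_top (by simp) hvol⟩)
  obtain ⟨θ, hθ, hθη⟩ := ENNReal.exists_nnreal_pos_mul_lt
    (ENNReal.mul_ne_top (ENNReal.ofReal_ne_top (r := R))
      (measure_ball_lt_top (μ := volume) (x := (0 : Euc n)) (r := R)).ne) hη3
  set ε₃ : ℝ := min ε₂ θ with hε₃
  have hε₃0 : 0 < ε₃ := lt_min hε₂ hθ
  obtain ⟨ℓ, hℓ, hcount⟩ := hvsm.exists_countable_setOf_fderiv_eq hε₃0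
  have hstep3 : ∫⁻ x in Metric.ball (0 : Euc n) R, ‖ℓ x‖ₑ ≤ η / 3 := by
    calc ∫⁻ x in Metric.ball (0 : Euc n) R, ‖ℓ x‖ₑ
        ≤ ∫⁻ _ in Metric.ball (0 : Euc n) R, (θ * ENNReal.ofReal R) := by
          refine setLIntegral_mono' measurableSet_ball fun x hx => ?_
          rw [← ofReal_norm, ← ENNReal.ofReal_coe_nnreal, ← ENNReal.ofReal_mul θ.coe_nonneg]
          refine ENNReal.ofReal_le_ofReal ((ℓ.le_opNorm x).trans ?_)
          exact mul_le_mul (hℓ.le.trans (min_le_right _ _)) (mem_ball_zero_iff.1 hx).le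
            (norm_nonneg x) θ.2
      _ = θ * (ENNReal.ofReal R * volume (Metric.ball (0 : Euc n) R)) := by
          rw [setLIntegral_const, mul_assoc]
      _ ≤ η / 3 := hθη.le
  refine ⟨fun x => v x - ℓ x, hvsm.sub ℓ.contDiff, ?_, ?_, ?_⟩
  · convert hcount using 3 with x
    rw [fderiv_fun_sub (hvsm.differentiable (by simp)).differentiableAt ℓ.differentiableAt,
      ℓ.fderiv, sub_eq_zero]
  · refine (fracVariation_clip_sub_le s hvsm.continuous.measurable ℓ hℓ.le Ω).trans ?_
    calc _ ≤ (fracPerimeter s E Ω + η / 2) + η / 2 := by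
          refine add_le_add hvar ((setLIntegral_touching_le Ω ε₃).trans ?_)
          refine (mul_le_mul_right (hker ε₃ hε₃0 (min_le_left _ _)) _).trans ?_
          exact ENNReal.mul_div_le
      _ = fracPerimeter s E Ω + η := by rw [add_assoc, ENNReal.add_halves]
  · have hm1 : Measurable fun x => ‖v x - (χ ∘ Φ) x‖ₑ :=
      (hvsm.continuous.measurable.sub hw).enorm
    have hm2 : Measurable fun x => ‖(χ ∘ Φ) x - χ x‖ₑ := (hw.sub hχm).enorm
    calc ∫⁻ x in Metric.ball (0 : Euc n) R, ‖v x - ℓ x - χ x‖ₑ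
        ≤ ∫⁻ x in Metric.ball (0 : Euc n) R,
            (‖v x - (χ ∘ Φ) x‖ₑ + ‖(χ ∘ Φ) x - χ x‖ₑ + ‖ℓ x‖ₑ) := by
          refine lintegral_mono fun x => ?_
          have : v x - ℓ x - χ x = (v x - (χ ∘ Φ) x) + ((χ ∘ Φ) x - χ x) - ℓ x := by ring
          rw [this]
          exact enorm_sub_le.trans (add_le_add (enorm_add_le _ _) le_rfl)
      _ = (∫⁻ x in Metric.ball (0 : Euc n) R, ‖v x - (χ ∘ Φ) x‖ₑ)
            + (∫⁻ x in Metric.ball (0 : Euc n) R, ‖(χ ∘ Φ) x - χ x‖ₑ)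
            + ∫⁻ x in Metric.ball (0 : Euc n) R, ‖ℓ x‖ₑ := by
          rw [← lintegral_add_left hm1]
          exact lintegral_add_left (hm1.add hm2) _
      _ ≤ η / 3 + η / 3 + η / 3 := add_le_add (add_le_add hstep2 hstep1) hstep3
      _ = η := ENNReal.add_thirds η

/-- Smooth sets realising the fractional perimeter in the limit. -/
lemma exists_smooth_liminf_fracPerimeter_le {n : ℕ} (hn : n ≠ 0) {s : ℝ} (hs0 : 0 < s)
    (hs1 : s < 1) {Ω : Set (Euc n)} (hopen : IsOpen Ω) (hb : Bornology.IsBounded Ω)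
    (hΩ : HasLipschitzBoundary Ω) {E : Set (Euc n)} (hE : MeasurableSet E)
    (hP : fracPerimeter s E Ω ≠ ⊤) :
    ∃ F : ℕ → Set (Euc n), (∀ h, IsOpen (F h) ∧ HasSmoothBoundary (F h)) ∧
      ConvergesLocally F E ∧
      liminf (fun h => fracPerimeter s (F h) Ω) atTop ≤ fracPerimeter s E Ω := by
  have hη : Tendsto (fun k : ℕ => ((k : ℝ≥0∞) + 1)⁻¹) atTop (𝓝 0) := by
    have := (tendsto_add_atTop_iff_nat 1).2 ENNReal.tendsto_inv_nat_nhds_zero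
    simpa using this
  choose u hu hcrit hvar hclose using fun k : ℕ =>
    exists_contDiff_approx hn hs0 hs1 hopen hb hΩ hE hP
      (η := ((k : ℝ≥0∞) + 1)⁻¹) (by simp) (k : ℝ)
  have hum : ∀ k, Measurable (u k) := fun k => (hu k).continuous.measurable
  have hmeas : ∀ k, Measurable fun t => fracPerimeter s {x | t < u k x} Ω := fun k =>
    measurable_fracPerimeter_superlevel s (hum k) hopen.measurableSet
  set μ : Measure ℝ := volume.restrict (Set.Ioo 0 1) with hμ
  have hprob : IsProbabilityMeasure μ := ⟨by simp [hμ]⟩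
  -- The levels to avoid: critical values of all the `u k`, countable in number, and levels outside
  -- `(0, 1)`.
  set N : Set ℝ := (⋃ k, u k '' {x | fderiv ℝ (u k) x = 0}) ∪ (Set.Ioo 0 1)ᶜ with hN
  have hN0 : μ N = 0 := by
    refine measure_union_null ?_ ?_
    · exact (Set.countable_iUnion fun k => (hcrit k).image _).measure_zero _
    · rw [hμ, Measure.restrict_apply measurableSet_Ioo.compl]
      simp
  -- Off a null set, some value of a function is at most its mean. Applied to the liminf over `k`,
  -- this yields one level for all `k`; Fatou and the coarea inequality then bound the mean.
  obtain ⟨t, htN, ht⟩ := exists_notMem_null_le_lintegral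
    (f := fun t => liminf (fun k => fracPerimeter s {x | t < u k x} Ω) atTop)
    (Measurable.liminf hmeas).aemeasurable hN0
  rw [hN, Set.mem_union, not_or, Set.notMem_compl_iff] at htN
  refine ⟨fun k => {x | t < u k x}, fun k => ⟨isOpen_lt continuous_const (hu k).continuous,
    hasSmoothBoundary_superlevel (hu k) fun x hx h0 => htN.1 ?_⟩,
    convergesLocally_superlevel hum hE htN.2 hη hclose, ht.trans ?_⟩
  · exact Set.mem_iUnion.2 ⟨k, x, h0, hx⟩
  · refine (lintegral_liminf_le hmeas).trans ?_
    refine (liminf_le_liminf (Eventually.of_forall fun k =>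
      (lintegral_fracPerimeter_superlevel_le s (hum k) hopen.measurableSet).trans
        (hvar k))).trans ?_
    have : Tendsto (fun k : ℕ => fracPerimeter s E Ω + ((k : ℝ≥0∞) + 1)⁻¹) atTop
        (𝓝 (fracPerimeter s E Ω + 0)) := tendsto_const_nhds.add hη
    rw [this.liminf_eq, add_zero]

theorem mainTheorem11 (n : ℕ) (s : ℝ) (hs0 : 0 < s) (hs1 : s < 1)
    (Ω : Set (EuclideanSpace ℝ (Fin n))) (hΩ_open : IsOpen Ω)
    (hΩ_bounded : Bornology.IsBounded Ω) (hΩ_lipschitz : HasLipschitzBoundary Ω)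
    (E : Set (EuclideanSpace ℝ (Fin n))) (hE : NullMeasurableSet E volume) :
    fracPerimeter s E Ω =
      sInf {L : ℝ≥0∞ | ∃ F : ℕ → Set (EuclideanSpace ℝ (Fin n)),
        (∀ h, IsOpen (F h) ∧ HasSmoothBoundary (F h)) ∧ ConvergesLocally F E ∧
          L = liminf (fun h => fracPerimeter s (F h) Ω) atTop} := by
  -- Perimeter and local convergence ignore null sets, so `E` may be replaced by a measurable set.
  obtain ⟨E', -, hE', hEE'⟩ := hE.exists_measurable_superset_ae_eq
  apply le_antisymm
  · refine le_sInf ?_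
    rintro L ⟨F, hF, hconv, rfl⟩
    rw [fracPerimeter_congr s hEE'.symm]
    exact fracPerimeter_le_liminf s hΩ_open.measurableSet (fun k => (hF k).1.measurableSet) hE'
      (hconv.congr hEE'.symm)
  -- In dimension 0 the space is a single point and every set is open with empty frontier, so the
  -- constant sequence `E` works.
  · rcases eq_or_ne n 0 with rfl | hn
    · refine sInf_le ⟨fun _ => E, fun _ => ⟨isOpen_discrete E, fun x hx => ?_⟩, ?_, by simp⟩
      · simp at hx
      · intro U _ _
        simp
    · rcases eq_or_ne (fracPerimeter s E Ω) ⊤ with htop | hP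
      · simp [htop]
      rw [fracPerimeter_congr s hEE'.symm] at hP ⊢
      obtain ⟨F, hF, hconv, hle⟩ := exists_smooth_liminf_fracPerimeter_le hn hs0 hs1 hΩ_open
        hΩ_bounded hΩ_lipschitz hE' hP
      refine (sInf_le ?_).trans hle
      exact ⟨F, hF, hconv.congr hEE', rfl⟩
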